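/- **Setting.** Let $\mathcal H$ be a separable complex Hilbert space and let $h$ be a (possibly unbounded) self-adjoint operator on $\mathcal H$ with compact resolvent. Let $\mathcal H_N=\mathcal H^{\otimes N}$ be the Hilbert space tensor power, and let $H_N=\sum_{j=1}^N h_j$, where $h_j$ acts as $h$ on the $j$th factor ($H_N$ is the closure of this sum on the span of the product vectors with factors in the domain of $h$). For an eigenvalue $E$ of $H_N$ let $P_E$ be the orthogonal projection onto the corresponding eigenspace, and let $\mathcal A_N$ be the algebra of all operators $\sum_E f(E)P_E$ (strongly convergent sum over the eigenvalues of $H_N$), $f$ a bounded complex function. A *collision specification* $(\mathcal C,U,\nu)$ consists of a compact metric space $\mathcal C$, an injective map $U$ from $\mathcal C$ to the unitary operators on $\mathcal H_2=\mathcal H\otimes\mathcal H$ that is continuous in the strong operator topology (in particular, it may be norm continuous), and a Borel probability measure $\nu$ on $\mathcal C$ that charges every non-empty open set, such that (i) $U(\sigma)H_2U(\sigma)^*=H_2$ for all $\sigma\in\mathcal C$; (ii) $U(\sigma_0)=1$ for some $\sigma_0\in\mathcal C$; (iii) $\{U(\sigma):\sigma\in\mathcal C\}=\{U(\sigma)^*:\sigma\in\mathcal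 C\}$, and the map $\sigma\mapsto\sigma'$ with $U(\sigma)^*=U(\sigma')$ is measurable and leaves $\nu$ invariant; (iv) with the swap $V(\phi\otimes\psi)=\psi\otimes\phi$, $\{U(\sigma):\sigma\in\mathcal C\}=\{VU(\sigma)V^*:\sigma\in\mathcal C\}$, and the map $\sigma\mapsto\sigma'$ with $VU(\sigma)V^*=U(\sigma')$ is measurable and leaves $\nu$ invariant. It is *(2-)ergodic* if the commutant $\{U(\sigma):\sigma\in\mathcal C\}'$ in the bounded operators on $\mathcal H_2$ equals $\mathcal A_2$. For $1\le i<j\le N$ let $U_{i,j}(\sigma)$ be the operator on $\mathcal H_N$ that acts as $U(\sigma)$ on the $i$th and $j$th factors and as the identity on the others, and let $$\mathscr C_N=\{U_{i,j}(\sigma): 1\le i<j\le N,\ \sigma\in\mathcal C\}'$$ be the commutant in the bounded operators on $\mathcal H_N$. **Theorem.** Let $(\mathcal C,U,\nu)$ be a (2-)ergodic collision specification and let $N\ge 2$. Then $\mathscr C_N$ is a commutative algebra. In fact, if $\{\psi_j\}_{j\in\mathcal J}$ is any orthonormal basis of $\mathcal H$ consisting of eigenvectors of $h$, then every $A\in\mathscr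 C_N$ is diagonal in the basis $\Psi_\alpha=\psi_{\alpha_1}\otimes\cdots\otimes\psi_{\alpha_N}$, $\alpha\in\mathcal J^N$, of $\mathcal H_N$: each $\Psi_\alpha$ is an eigenvector of $A$. -/

import Mathlib

open MeasureTheory

namespace QuantumKac

universe u

/-! ## The Hilbert space tensor power -/

section TensorPower

variable (N : ℕ) (H : Type u) [NormedAddCommGroup H] [InnerProductSpace ℂ H]

/-- The algebraic `N`-fold tensor power of `H`.  (A type synonym, so that it does not carry the
projective seminorm that Mathlib puts on tensor products of normed spaces.) -/
def AlgTensor : Type u := PiTensorProduct ℂ (fun _ : Fin N => H)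

noncomputable instance : AddCommGroup (AlgTensor N H) :=
  inferInstanceAs (AddCommGroup (PiTensorProduct ℂ (fun _ : Fin N => H)))

noncomputable instance : Module ℂ (AlgTensor N H) :=
  inferInstanceAs (Module ℂ (PiTensorProduct ℂ (fun _ : Fin N => H)))

variable {N H}

/-- The elementary tensor `φ₁ ⊗ ⋯ ⊗ φ_N` in the algebraic tensor power. -/
noncomputable def algPure : MultilinearMap ℂ (fun _ : Fin N => H) (AlgTensor N H) :=
  PiTensorProduct.tprod ℂ

theorem algTensor_induction {p : AlgTensor N H → Prop} (z : AlgTensor N H)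
    (hs : ∀ (r : ℂ) (φ : Fin N → H), p (r • algPure φ))
    (ha : ∀ x y, p x → p y → p (x + y)) : p z :=
  PiTensorProduct.induction_on z hs ha

/-- The linear functional `y₁ ⊗ ⋯ ⊗ y_N ↦ ∏ k, ⟪φ k, y k⟫`. -/
noncomputable def pairing (φ : Fin N → H) : AlgTensor N H →ₗ[ℂ] ℂ :=
  PiTensorProduct.lift
    ((MultilinearMap.mkPiAlgebra ℂ (Fin N) ℂ).compLinearMap fun k => innerₛₗ ℂ (φ k))

theorem pairing_pure (φ y : Fin N → H) :
    pairing φ (algPure y) = ∏ k, inner ℂ (φ k) (y k) := by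
  unfold pairing algPure
  erw [PiTensorProduct.lift.tprod]
  simp

/-- For fixed `y`, the complex conjugate of `φ ↦ pairing φ y`; it is multilinear in `φ`. -/
noncomputable def conjPairing (y : AlgTensor N H) :
    MultilinearMap ℂ (fun _ : Fin N => H) ℂ where
  toFun φ := star (pairing φ y)
  map_update_add' := by
    intro hd φ i a b
    have hd' : hd = instDecidableEqFin N := Subsingleton.elim _ _
    subst hd'
    induction y using algTensor_induction with
    | hs r x =>
      have key := ((MultilinearMap.mkPiAlgebra ℂ (Fin N) ℂ).compLinearMap
        fun k => innerₛₗ ℂ (x k)).map_update_add φ i a b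
      simp only [MultilinearMap.compLinearMap_apply, MultilinearMap.mkPiAlgebra_apply,
        innerₛₗ_apply_apply] at key
      simp only [map_smul, pairing_pure, smul_eq_mul, star_mul', star_prod,
        RCLike.star_def, inner_conj_symm, key, mul_add]
    | ha x z hx hz => simp only [map_add, star_add, hx, hz]; ring
  map_update_smul' := by
    intro hd φ i c a
    have hd' : hd = instDecidableEqFin N := Subsingleton.elim _ _
    subst hd'
    induction y using algTensor_induction with
    | hs r x =>
      have key := ((MultilinearMap.mkPiAlgebra ℂ (Fin N) ℂ).compLinearMap
        fun k => innerₛₗ ℂ (x k)).map_update_smul φ i c a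
      simp only [MultilinearMap.compLinearMap_apply, MultilinearMap.mkPiAlgebra_apply,
        innerₛₗ_apply_apply, smul_eq_mul] at key
      simp only [map_smul, pairing_pure, smul_eq_mul, star_mul', star_prod,
        RCLike.star_def, inner_conj_symm, key]
      ring
    | ha x z hx hz => simp only [map_add, star_add, hx, hz, smul_add]

/-- The sesquilinear form on the algebraic tensor power that is determined by
`⟪x₁ ⊗ ⋯ ⊗ x_N, y₁ ⊗ ⋯ ⊗ y_N⟫ = ∏ k, ⟪x k, y k⟫`. -/
noncomputable def algInner (x y : AlgTensor N H) : ℂ :=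
  star ((PiTensorProduct.lift (conjPairing y) : AlgTensor N H →ₗ[ℂ] ℂ) x)

theorem algInner_pure_left (φ : Fin N → H) (y : AlgTensor N H) :
    algInner (algPure φ) y = pairing φ y := by
  unfold algInner algPure
  erw [PiTensorProduct.lift.tprod]
  simp [conjPairing]

theorem algInner_pure (φ y : Fin N → H) :
    algInner (algPure φ) (algPure y) = ∏ k, inner ℂ (φ k) (y k) := by
  rw [algInner_pure_left, pairing_pure]

theorem algInner_add_left (x x' y : AlgTensor N H) :
    algInner (x + x') y = algInner x y + algInner x' y :=
  (congrArg star (map_add (PiTensorProduct.lift (conjPairing y)) x x')).trans (star_add _ _)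

theorem algInner_smul_left (c : ℂ) (x y : AlgTensor N H) :
    algInner (c • x) y = star c * algInner x y :=
  (congrArg star (map_smul (PiTensorProduct.lift (conjPairing y)) c x)).trans (star_mul' _ _)

theorem algInner_add_right (x y y' : AlgTensor N H) :
    algInner x (y + y') = algInner x y + algInner x y' := by
  induction x using algTensor_induction with
  | hs r φ => simp only [algInner_smul_left, algInner_pure_left, map_add, mul_add]
  | ha a b ha hb => simp only [algInner_add_left, ha, hb]; ring

theorem algInner_smul_right (c : ℂ) (x y : AlgTensor N H) :
    algInner x (c • y) = c * algInner x y := by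
  induction x using algTensor_induction with
  | hs r φ => simp only [algInner_smul_left, algInner_pure_left, map_smul, smul_eq_mul]; ring
  | ha a b ha hb => simp only [algInner_add_left, ha, hb]; ring

theorem algInner_conj_symm (x y : AlgTensor N H) : star (algInner y x) = algInner x y := by
  induction x using algTensor_induction with
  | hs r φ =>
    induction y using algTensor_induction with
    | hs s y =>
      simp only [algInner_smul_left, algInner_smul_right, algInner_pure, star_mul', star_prod,
        RCLike.star_def, inner_conj_symm, Complex.conj_conj]
      ring
    | ha a b ha hb => simp only [algInner_add_left, algInner_add_right, star_add, ha, hb]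
  | ha a b ha hb => simp only [algInner_add_left, algInner_add_right, star_add, ha, hb]

open scoped ComplexOrder in
theorem posSemidef_prod_gram {ι : Type*} [Fintype ι] (x : ι → Fin N → H) (s : Finset (Fin N)) :
    (Matrix.of fun a b => ∏ k ∈ s, inner ℂ (x a k) (x b k) : Matrix ι ι ℂ).PosSemidef := by
  classical
  induction s using Finset.induction_on with
  | empty =>
    have h1 := Matrix.posSemidef_gram (n := ι) ℂ (fun _ => (1 : ℂ))
    have h2 : (Matrix.of fun a b => ∏ k ∈ (∅ : Finset (Fin N)), inner ℂ (x a k) (x b k) :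
        Matrix ι ι ℂ) = Matrix.gram ℂ fun _ => (1 : ℂ) := by
      ext a b
      simp [Matrix.gram]
    rw [h2]
    exact h1
  | insert k s hk ih =>
    have h1 := (Matrix.posSemidef_gram (n := ι) ℂ (fun a => x a k)).hadamard ih
    have h2 : (Matrix.of fun a b => ∏ l ∈ insert k s, inner ℂ (x a l) (x b l) :
        Matrix ι ι ℂ) = (Matrix.gram ℂ fun a => x a k).hadamard
          (Matrix.of fun a b => ∏ l ∈ s, inner ℂ (x a l) (x b l)) := by
      ext a b
      simp [Matrix.gram, Finset.prod_insert hk]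
    rw [h2]
    exact h1

theorem exists_finite_sum (z : AlgTensor N H) :
    ∃ (n : ℕ) (c : Fin n → ℂ) (x : Fin n → Fin N → H), z = ∑ a, c a • algPure (x a) := by
  induction z using algTensor_induction with
  | hs r φ => exact ⟨1, fun _ => r, fun _ => φ, by simp⟩
  | ha y z hy hz =>
    obtain ⟨n, c, x, rfl⟩ := hy
    obtain ⟨m, d, w, rfl⟩ := hz
    exact ⟨n + m, Fin.append c d, Fin.append x w, by simp [Fin.sum_univ_add]⟩

open scoped ComplexOrder in
theorem algInner_self_nonneg (z : AlgTensor N H) : 0 ≤ (algInner z z).re := by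
  obtain ⟨n, c, x, rfl⟩ := exists_finite_sum z
  have hl : ∀ y : AlgTensor N H, algInner (∑ a, c a • algPure (x a)) y
      = ∑ a, star (c a) * algInner (algPure (x a)) y := by
    intro y
    let L : AlgTensor N H →+ ℂ := AddMonoidHom.mk' (fun w => algInner w y)
      fun a b => algInner_add_left a b y
    change L _ = _
    rw [map_sum]
    exact Finset.sum_congr rfl fun a _ => algInner_smul_left _ _ _
  have hr : ∀ a, algInner (algPure (x a)) (∑ b, c b • algPure (x b))
      = ∑ b, c b * ∏ k, inner ℂ (x a k) (x b k) := by
    intro a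
    rw [algInner_pure_left, map_sum]
    exact Finset.sum_congr rfl fun b _ => by rw [map_smul, pairing_pure, smul_eq_mul]
  have hp := (posSemidef_prod_gram x Finset.univ).dotProduct_mulVec_nonneg c
  have he : algInner (∑ a, c a • algPure (x a)) (∑ a, c a • algPure (x a))
      = star c ⬝ᵥ (Matrix.of fun a b => ∏ k, inner ℂ (x a k) (x b k)).mulVec c := by
    rw [hl]
    simp only [hr, dotProduct, Matrix.mulVec, Matrix.of_apply, Pi.star_apply]
    exact Finset.sum_congr rfl fun a _ => by
      congr 1
      exact Finset.sum_congr rfl fun b _ => mul_comm _ _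
  rw [he]
  exact (Complex.le_def.mp hp).1

/-- The (pre-)inner product of the algebraic tensor power. -/
@[reducible]
noncomputable def algCore : PreInnerProductSpace.Core ℂ (AlgTensor N H) where
  inner := algInner
  conj_inner_symm := algInner_conj_symm
  re_inner_nonneg := algInner_self_nonneg
  add_left := algInner_add_left
  smul_left x y c := algInner_smul_left c x y

noncomputable instance : SeminormedAddCommGroup (AlgTensor N H) :=
  InnerProductSpace.Core.toSeminormedAddCommGroup (c := algCore)

noncomputable instance : InnerProductSpace ℂ (AlgTensor N H) :=
  InnerProductSpace.ofCore algCore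

variable (N H)

/-- The Hilbert space `H^{⊗N}`: the completion of the algebraic tensor power. -/
abbrev TensorPower : Type u := UniformSpace.Completion (AlgTensor N H)

variable {N H}

/-- The elementary tensor `φ₁ ⊗ ⋯ ⊗ φ_N` in `H^{⊗N}`. -/
noncomputable def prodVec (φ : Fin N → H) : TensorPower N H :=
  ((algPure φ : AlgTensor N H) : UniformSpace.Completion (AlgTensor N H))

theorem inner_prodVec (φ y : Fin N → H) :
    inner ℂ (prodVec φ) (prodVec y) = ∏ k, inner ℂ (φ k) (y k) :=
  (UniformSpace.Completion.inner_coe _ _).trans (algInner_pure φ y)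

theorem dense_span_prodVec :
    Dense (Submodule.span ℂ (Set.range (prodVec (N := N) (H := H))) : Set (TensorPower N H)) := by
  have hd := UniformSpace.Completion.denseRange_coe (α := AlgTensor N H)
  refine hd.mono ?_
  rintro _ ⟨z, rfl⟩
  induction z using algTensor_induction with
  | hs r φ =>
    rw [UniformSpace.Completion.coe_smul]
    exact Submodule.smul_mem _ _ (Submodule.subset_span ⟨φ, rfl⟩)
  | ha x y hx hy =>
    rw [UniformSpace.Completion.coe_add]
    exact Submodule.add_mem _ hx hy

theorem continuous_prodVec : Continuous (prodVec (N := N) (H := H)) := by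
  rw [continuous_iff_continuousAt]
  intro θ
  rw [ContinuousAt, tendsto_iff_norm_sub_tendsto_zero]
  have hsq : ∀ φ : Fin N → H, ‖prodVec φ - prodVec θ‖ ^ 2
      = (∏ k, inner ℂ (φ k) (φ k) - ∏ k, inner ℂ (φ k) (θ k) - ∏ k, inner ℂ (θ k) (φ k)
          + ∏ k, inner ℂ (θ k) (θ k) : ℂ).re := by
    intro φ
    rw [← inner_self_eq_norm_sq (𝕜 := ℂ), inner_sub_left, inner_sub_right, inner_sub_right]
    simp only [inner_prodVec, RCLike.re_eq_complex_re]
    congr 1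
    ring
  have hc : Continuous fun φ : Fin N → H => √((∏ k, inner ℂ (φ k) (φ k)
      - ∏ k, inner ℂ (φ k) (θ k) - ∏ k, inner ℂ (θ k) (φ k)
          + ∏ k, inner ℂ (θ k) (θ k) : ℂ).re) := by
    fun_prop
  have h0 := hc.tendsto θ
  simp only [sub_self, zero_sub, neg_add_cancel, Complex.zero_re, Real.sqrt_zero] at h0
  refine h0.congr fun φ => ?_
  rw [← hsq, Real.sqrt_sq (norm_nonneg _)]

end TensorPower

/-! ## Operators defined on elementary tensors -/

section Extension

variable {I : Type*} {K L : Type*} [NormedAddCommGroup K] [InnerProductSpace ℂ K]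
  [NormedAddCommGroup L] [InnerProductSpace ℂ L] [CompleteSpace L]

/-- The bounded operator `K → L` that sends `v a` to `w a` for every `a`, where the vectors `v a`
span a dense subspace of `K` (and where the prescription is bounded on that span). -/
noncomputable def extendBounded (v : I → K) (w : I → L) : K →L[ℂ] L :=
  (Finsupp.linearCombination ℂ w).extendOfNorm (Finsupp.linearCombination ℂ v)

theorem extendBounded_apply (v : I → K) (w : I → L)
    (hv : Dense (Submodule.span ℂ (Set.range v) : Set K)) (c : ℝ)
    (hvw : ∀ a b, inner ℂ (w a) (w b) = (c : ℂ) * inner ℂ (v a) (v b)) (a : I) :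
    extendBounded v w (v a) = w a := by
  have hsum : ∀ f : I →₀ ℂ,
      inner ℂ (Finsupp.linearCombination ℂ w f) (Finsupp.linearCombination ℂ w f)
        = (c : ℂ) * inner ℂ (Finsupp.linearCombination ℂ v f)
            (Finsupp.linearCombination ℂ v f) := by
    intro f
    simp only [Finsupp.linearCombination_apply, Finsupp.sum, sum_inner, inner_sum,
      inner_smul_left, inner_smul_right, hvw, Finset.mul_sum]
    refine Finset.sum_congr rfl fun x _ => Finset.sum_congr rfl fun y _ => by ring
  have hsq : ∀ f : I →₀ ℂ, ‖Finsupp.linearCombination ℂ w f‖ ^ 2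
      = c * ‖Finsupp.linearCombination ℂ v f‖ ^ 2 := by
    intro f
    have := hsum f
    rw [inner_self_eq_norm_sq_to_K, inner_self_eq_norm_sq_to_K] at this
    apply Complex.ofReal_injective
    push_cast
    exact this
  have hb : ∃ C : ℝ, ∀ f : I →₀ ℂ, ‖Finsupp.linearCombination ℂ w f‖
      ≤ C * ‖Finsupp.linearCombination ℂ v f‖ := by
    refine ⟨√|c|, fun f => ?_⟩
    refine abs_le_of_sq_le_sq' ?_ (by positivity) |>.2
    rw [mul_pow, Real.sq_sqrt (abs_nonneg c), hsq f]
    exact mul_le_mul_of_nonneg_right (le_abs_self c) (by positivity)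
  have hd : DenseRange (Finsupp.linearCombination ℂ v) := by
    have : Set.range (Finsupp.linearCombination ℂ v)
        = (Submodule.span ℂ (Set.range v) : Set K) := by
      rw [← Finsupp.range_linearCombination]
      rfl
    unfold DenseRange
    rw [this]
    exact hv
  have := LinearMap.extendOfNorm_eq hd hb (Finsupp.single a (1 : ℂ))
  simpa [extendBounded] using this

end Extension

section PairOperators

variable {N : ℕ} {H : Type u} [NormedAddCommGroup H] [InnerProductSpace ℂ H]

/-- The factors of a product vector, with the `i`th replaced by `x` and the `j`th by `y`. -/
def replacePair {M : ℕ} {G : Type*} (i j : Fin M) (φ : Fin M → G) (x y : G) : Fin M → G :=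
  Function.update (Function.update φ i x) j y

/-- For `i ≠ j`, the bounded operator `H ⊗ H → H^{⊗N}` that puts a vector of `H ⊗ H` in the
factors `i` and `j` and keeps `φ k` in every other factor `k`:
`x ⊗ y ↦ φ₁ ⊗ ⋯ ⊗ x ⊗ ⋯ ⊗ y ⊗ ⋯ ⊗ φ_N`. -/
noncomputable def insertPair (i j : Fin N) (φ : Fin N → H) :
    TensorPower 2 H →L[ℂ] TensorPower N H :=
  extendBounded (prodVec (N := 2)) fun x => prodVec (replacePair i j φ (x 0) (x 1))

/-- For `i ≠ j` and an operator `B` on `H ⊗ H`, the operator `B_{i,j}` on `H^{⊗N}` in which `B`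
acts on the factors `i` and `j` and the identity on the others. -/
noncomputable def pairOp (i j : Fin N) (B : TensorPower 2 H →L[ℂ] TensorPower 2 H) :
    TensorPower N H →L[ℂ] TensorPower N H :=
  extendBounded (prodVec (N := N)) fun φ => insertPair i j φ (B (prodVec ![φ i, φ j]))

theorem prod_replacePair {i j : Fin N} (hij : i ≠ j) (φ θ : Fin N → H) (x y x' y' : H) :
    ∏ k, inner ℂ (replacePair i j φ x y k) (replacePair i j θ x' y' k)
      = (∏ k ∈ (Finset.univ.erase j).erase i, inner ℂ (φ k) (θ k))
          * (inner ℂ x x' * inner ℂ y y') := by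
  rw [← Finset.mul_prod_erase Finset.univ _ (Finset.mem_univ j),
    ← Finset.mul_prod_erase (Finset.univ.erase j) _
      (Finset.mem_erase.mpr ⟨hij, Finset.mem_univ i⟩)]
  have : ∏ k ∈ (Finset.univ.erase j).erase i,
      inner ℂ (replacePair i j φ x y k) (replacePair i j θ x' y' k)
      = ∏ k ∈ (Finset.univ.erase j).erase i, inner ℂ (φ k) (θ k) := by
    refine Finset.prod_congr rfl fun k hk => ?_
    simp only [Finset.mem_erase, Finset.mem_univ, and_true] at hk
    simp [replacePair, hk.1, hk.2]
  rw [this]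
  simp [replacePair, hij]
  ring

theorem insertPair_prodVec {i j : Fin N} (hij : i ≠ j) (φ : Fin N → H) (x : Fin 2 → H) :
    insertPair i j φ (prodVec x) = prodVec (replacePair i j φ (x 0) (x 1)) := by
  refine extendBounded_apply _ _ dense_span_prodVec
    (∏ k ∈ (Finset.univ.erase j).erase i, ‖φ k‖ ^ 2) (fun a b => ?_) x
  rw [inner_prodVec, inner_prodVec, prod_replacePair hij, Fin.prod_univ_two]
  congr 1
  push_cast
  exact Finset.prod_congr rfl fun k _ => inner_self_eq_norm_sq_to_K _

theorem inner_insertPair {i j : Fin N} (hij : i ≠ j) (φ θ : Fin N → H) (u v : TensorPower 2 H) :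
    inner ℂ (insertPair i j φ u) (insertPair i j θ v)
      = (∏ k ∈ (Finset.univ.erase j).erase i, inner ℂ (φ k) (θ k)) * inner ℂ u v := by
  set c : ℂ := ∏ k ∈ (Finset.univ.erase j).erase i, inner ℂ (φ k) (θ k) with hc
  have pp : ∀ x y : Fin 2 → H,
      inner ℂ (insertPair i j φ (prodVec x)) (insertPair i j θ (prodVec y))
        = c * inner ℂ (prodVec x) (prodVec y) := fun x y => by
    rw [insertPair_prodVec hij, insertPair_prodVec hij, inner_prodVec, inner_prodVec, prod_replacePair hij,
      Fin.prod_univ_two]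
  have pv : ∀ (x : Fin 2 → H) (v : TensorPower 2 H),
      inner ℂ (insertPair i j φ (prodVec x)) (insertPair i j θ v) = c * inner ℂ (prodVec x) v := by
    intro x v
    have : innerSL ℂ (insertPair i j φ (prodVec x)) ∘L insertPair i j θ = c • innerSL ℂ (prodVec x) := by
      refine ContinuousLinearMap.ext_on dense_span_prodVec ?_
      rintro _ ⟨y, rfl⟩
      simpa using pp x y
    simpa using congrArg (fun T => T v) this
  have : innerSL ℂ (insertPair i j θ v) ∘L insertPair i j φ = star c • innerSL ℂ v := by
    refine ContinuousLinearMap.ext_on dense_span_prodVec ?_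
    rintro _ ⟨x, rfl⟩
    have := congrArg star (pv x v)
    simpa [inner_conj_symm] using this
  have h1 := congrArg star (congrArg (fun T => T u) this)
  simpa [inner_conj_symm] using h1

theorem replacePair_self {M : ℕ} {G : Type*} {i j : Fin M} (φ : Fin M → G) :
    replacePair i j φ (φ i) (φ j) = φ := by
  simp [replacePair]

theorem pairOp_prodVec {i j : Fin N} (hij : i ≠ j)
    (B : TensorPower 2 H →L[ℂ] TensorPower 2 H)
    (hB : ∀ u v, inner ℂ (B u) (B v) = inner ℂ u v) (φ : Fin N → H) :
    pairOp i j B (prodVec φ) = insertPair i j φ (B (prodVec ![φ i, φ j])) := by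
  refine extendBounded_apply _ _ dense_span_prodVec 1 (fun a b => ?_) φ
  rw [inner_insertPair hij, hB, inner_prodVec, inner_prodVec, Fin.prod_univ_two]
  have := prod_replacePair hij a b (a i) (a j) (b i) (b j)
  rw [replacePair_self, replacePair_self] at this
  simp [this]

end PairOperators

section Swap

variable {H : Type u} [NormedAddCommGroup H] [InnerProductSpace ℂ H]

/-- The swap `V` on `H ⊗ H`, `V (x ⊗ y) = y ⊗ x`. -/
noncomputable def swapOp : TensorPower 2 H →L[ℂ] TensorPower 2 H :=
  extendBounded (prodVec (N := 2)) fun x => prodVec ![x 1, x 0]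

theorem swapOp_prodVec (x : Fin 2 → H) : swapOp (prodVec x) = prodVec ![x 1, x 0] := by
  refine extendBounded_apply _ _ dense_span_prodVec 1 (fun a b => ?_) x
  simp [inner_prodVec, Fin.prod_univ_two, mul_comm]

end Swap

/-! ## Hamiltonians, energy shells and the energy algebra -/

section Hamiltonian

variable {H : Type u} [NormedAddCommGroup H] [InnerProductSpace ℂ H]

/-- An (unbounded) operator `h` has compact resolvent: for some `z`, the operator `h - z` maps the
domain of `h` bijectively onto the space, with a compact inverse `R`. -/
def HasCompactResolvent (h : H →ₗ.[ℂ] H) : Prop :=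
  ∃ (z : ℂ) (R : H →L[ℂ] H), IsCompactOperator R ∧
    (∀ x : h.domain, R (h x - z • (x : H)) = x) ∧
    ∀ y : H, ∃ x : h.domain, (x : H) = R y ∧ h x - z • (x : H) = y

/-- The graph of the `N`-particle Hamiltonian `H_N = ∑ j, h_j`: the closure of the graph of the
operator `φ₁ ⊗ ⋯ ⊗ φ_N ↦ ∑ j, φ₁ ⊗ ⋯ ⊗ h φ_j ⊗ ⋯ ⊗ φ_N` on the span of the product vectors with
all factors in the domain of `h`.  So `(x, y)` belongs to it iff `x` is in the domain of `H_N`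
and `H_N x = y`. -/
noncomputable def hamiltonianGraph (N : ℕ) (h : H →ₗ.[ℂ] H) :
    Submodule ℂ (TensorPower N H × TensorPower N H) :=
  (Submodule.span ℂ (Set.range fun φ : Fin N → h.domain =>
    ((prodVec fun k => (φ k : H)),
      ∑ j, prodVec (Function.update (fun k => (φ k : H)) j (h (φ j)))))).topologicalClosure

theorem hamiltonianGraph_symmetric {N : ℕ} {h : H →ₗ.[ℂ] H}
    (hs : ∀ x y : h.domain, inner ℂ (h x) (y : H) = inner ℂ (x : H) (h y))
    {p q : TensorPower N H × TensorPower N H} (hp : p ∈ hamiltonianGraph N h)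
    (hq : q ∈ hamiltonianGraph N h) : inner ℂ p.2 q.1 = inner ℂ p.1 q.2 := by
  have base : ∀ φ θ : Fin N → h.domain,
      inner ℂ (∑ j, prodVec (Function.update (fun k => (φ k : H)) j (h (φ j))))
          (prodVec fun k => (θ k : H))
        = inner ℂ (prodVec fun k => (φ k : H))
          (∑ j, prodVec (Function.update (fun k => (θ k : H)) j (h (θ j)))) := by
    intro φ θ
    rw [sum_inner, inner_sum]
    refine Finset.sum_congr rfl fun j _ => ?_
    rw [inner_prodVec, inner_prodVec]
    refine Finset.prod_congr rfl fun k _ => ?_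
    by_cases hk : k = j
    · subst hk
      simpa using hs (φ k) (θ k)
    · simp [hk]
  have step : ∀ p : TensorPower N H × TensorPower N H,
      IsClosed {q : TensorPower N H × TensorPower N H | inner ℂ p.2 q.1 = inner ℂ p.1 q.2} :=
    fun p => isClosed_eq (by fun_prop) (by fun_prop)
  have step' : ∀ q : TensorPower N H × TensorPower N H,
      IsClosed {p : TensorPower N H × TensorPower N H | inner ℂ p.2 q.1 = inner ℂ p.1 q.2} :=
    fun q => isClosed_eq (by fun_prop) (by fun_prop)
  refine closure_minimal ?_ (step' q) hp
  intro p hp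
  refine closure_minimal ?_ (step p) hq
  intro q hq
  simp only [Set.mem_ofPred_eq]
  induction hp using Submodule.span_induction with
  | mem p hp =>
    obtain ⟨φ, rfl⟩ := hp
    induction hq using Submodule.span_induction with
    | mem q hq =>
      obtain ⟨θ, rfl⟩ := hq
      exact base φ θ
    | zero => simp
    | add x y _ _ hx hy => simp only [Prod.fst_add, Prod.snd_add, inner_add_right, hx, hy]
    | smul c x _ hx => simp only [Prod.smul_fst, Prod.smul_snd, inner_smul_right, hx]
  | zero => simp
  | add x y _ _ hx hy => simp only [Prod.fst_add, Prod.snd_add, inner_add_left, hx, hy]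
  | smul c x _ hx => simp only [Prod.smul_fst, Prod.smul_snd, inner_smul_left, hx]

/-- The graph of `H_N` is indeed the graph of an operator. -/
theorem hamiltonianGraph_functional {N : ℕ} {h : H →ₗ.[ℂ] H}
    (hd : Dense (h.domain : Set H))
    (hs : ∀ x y : h.domain, inner ℂ (h x) (y : H) = inner ℂ (x : H) (h y))
    {x y y' : TensorPower N H} (hy : (x, y) ∈ hamiltonianGraph N h)
    (hy' : (x, y') ∈ hamiltonianGraph N h) : y = y' := by
  have h0 : ((0 : TensorPower N H), y - y') ∈ hamiltonianGraph N h := by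
    simpa using Submodule.sub_mem _ hy hy'
  have h1 : ∀ φ : Fin N → H, inner ℂ (y - y') (prodVec φ) = 0 := by
    have hdp : Dense (Set.univ.pi fun _ : Fin N => (h.domain : Set H)) :=
      dense_pi Set.univ fun _ _ => hd
    have hcl : IsClosed {φ : Fin N → H | inner ℂ (y - y') (prodVec φ) = 0} :=
      isClosed_eq (continuous_const.inner continuous_prodVec) continuous_const
    intro φ
    refine closure_minimal ?_ hcl (hdp φ)
    intro φ hφ
    have hm := hamiltonianGraph_symmetric hs h0 (Submodule.le_topologicalClosure _
      (Submodule.subset_span ⟨fun k => (⟨φ k, hφ k (Set.mem_univ k)⟩ : h.domain), rfl⟩))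
    simpa using hm
  have h2 : innerSL ℂ (y - y') = 0 := by
    refine ContinuousLinearMap.ext_on dense_span_prodVec ?_
    rintro _ ⟨φ, rfl⟩
    exact h1 φ
  exact sub_eq_zero.mp (inner_self_eq_zero (𝕜 := ℂ).mp (congrArg (fun T => T (y - y')) h2))

/-- The eigenspace of `H_N` at the energy `E`. -/
noncomputable def energyShell (N : ℕ) (h : H →ₗ.[ℂ] H) (E : ℝ) :
    Submodule ℂ (TensorPower N H) :=
  (hamiltonianGraph N h).comap (LinearMap.id.prod ((E : ℂ) • LinearMap.id))

theorem isClosed_energyShell (N : ℕ) (h : H →ₗ.[ℂ] H) (E : ℝ) :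
    IsClosed (energyShell N h E : Set (TensorPower N H)) :=
  (Submodule.isClosed_topologicalClosure _).preimage
    (continuous_id.prodMk (continuous_const_smul (E : ℂ)))

instance (N : ℕ) (h : H →ₗ.[ℂ] H) (E : ℝ) : CompleteSpace (energyShell N h E) :=
  (isClosed_energyShell N h E).completeSpace_coe

/-- The energies, that is, the eigenvalues of `H_N`.  (When `h` is bounded below and has compact
resolvent, they form the whole spectrum of `H_N`; in any case `P_E = 0` for every other `E`.) -/
def energySpectrum (N : ℕ) (h : H →ₗ.[ℂ] H) : Set ℝ :=
  {E | energyShell N h E ≠ ⊥}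

/-- The energy algebra: the operators `f(H_N) = ∑ E, f(E) P_E`, `f` bounded on the spectrum,
where `P_E` is the orthogonal projection onto the energy shell at `E` (and where the sum converges
strongly). -/
def energyAlgebra (N : ℕ) (h : H →ₗ.[ℂ] H) : Set (TensorPower N H →L[ℂ] TensorPower N H) :=
  {A | ∃ f : energySpectrum N h → ℂ, (∃ M : ℝ, ∀ E, ‖f E‖ ≤ M) ∧
    ∀ x, HasSum (fun E : energySpectrum N h => f E • (energyShell N h E).starProjection x) (A x)}

end Hamiltonian

/-! ## Collision specifications -/

section Collisions

variable {H : Type u} [NormedAddCommGroup H] [InnerProductSpace ℂ H]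

/-- A collision specification `(C, U, ν)` for the single-particle Hamiltonian `h`.  Continuity of
`U` is meant in the strong operator topology, which is implied by continuity in norm. -/
structure CollisionSpecification (h : H →ₗ.[ℂ] H) (C : Type*) [MetricSpace C] [CompactSpace C]
    [MeasurableSpace C] [BorelSpace C] where
  /-- the unitary operators on `H ⊗ H` that describe the collisions -/
  U : C → unitary (TensorPower 2 H →L[ℂ] TensorPower 2 H)
  /-- the law of the collision parameter -/
  ν : Measure C
  continuous_U : ∀ x, Continuous fun σ => (U σ : TensorPower 2 H →L[ℂ] TensorPower 2 H) x
  injective_U : Function.Injective U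
  isProbabilityMeasure : IsProbabilityMeasure ν
  /-- `ν` charges every non-empty open set -/
  isOpenPosMeasure : ν.IsOpenPosMeasure
  /-- `U σ` commutes with `H_2`, that is, `(U σ) H_2 (U σ)* = H_2` as unbounded operators -/
  commute_hamiltonian : ∀ σ, ∀ p : TensorPower 2 H × TensorPower 2 H,
    ((U σ : TensorPower 2 H →L[ℂ] TensorPower 2 H) p.1,
      (U σ : TensorPower 2 H →L[ℂ] TensorPower 2 H) p.2) ∈ hamiltonianGraph 2 h ↔
      p ∈ hamiltonianGraph 2 h
  exists_trivial : ∃ σ₀, U σ₀ = 1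
  /-- the family of the `U σ` is closed under adjoints, and the map `τ` of `C` with
  `(U σ)* = U (τ σ)` is measurable and leaves `ν` invariant -/
  reversible : ∃ τ : C → C, (∀ σ, star (U σ) = U (τ σ)) ∧ MeasurePreserving τ ν ν
  /-- the family of the `U σ` is closed under conjugation by the swap `V = V*`, and the map `τ`
  of `C` with `V (U σ) V* = U (τ σ)` is measurable and leaves `ν` invariant -/
  swap_symmetric : ∃ τ : C → C,
    (∀ σ, (swapOp ∘L (U σ : TensorPower 2 H →L[ℂ] TensorPower 2 H)) ∘L swapOp.adjoint
      = (U (τ σ) : TensorPower 2 H →L[ℂ] TensorPower 2 H)) ∧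
      MeasurePreserving τ ν ν

namespace CollisionSpecification

variable {h : H →ₗ.[ℂ] H} {C : Type*} [MetricSpace C] [CompactSpace C] [MeasurableSpace C]
  [BorelSpace C]

/-- The specification is (2-)ergodic: the commutant of the operators `U σ` on `H ⊗ H` is the
energy algebra of two particles. -/
def IsErgodic (S : CollisionSpecification h C) : Prop :=
  (Set.range fun σ => (S.U σ : TensorPower 2 H →L[ℂ] TensorPower 2 H)).centralizer
    = energyAlgebra 2 h

/-- The commutant of all operators `U_{i,j}(σ)`, `i < j`, on `H^{⊗N}`. -/
noncomputable def commutant (S : CollisionSpecification h C) (N : ℕ) :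
    Subalgebra ℂ (TensorPower N H →L[ℂ] TensorPower N H) :=
  Subalgebra.centralizer ℂ
    {T | ∃ (i j : Fin N) (σ : C), i < j ∧ T = pairOp i j (S.U σ)}

end CollisionSpecification

end Collisions

end QuantumKac

/-!
Fix an orthonormal basis `ψ` of eigenvectors of `h`. Freezing all factors but the `i`th and the
`j`th turns an operator `A` on `H^{⊗N}` into an operator on `H ⊗ H`, and if `A` commutes with
every `U_{i,j}(σ)`, then this slice commutes with every `U(σ)`. By ergodicity the slice is a
function of `H_2`, so it is diagonal in the basis `ψ_a ⊗ ψ_b`. Two distinct multi-indices `α`, `β`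
differ at some `i` or `j`, and `⟪Ψ_α, A Ψ_β⟫` is then an off-diagonal entry of a slice, hence zero.
For commutativity some basis `ψ` has to exist: `h` has only countably many eigenvalues, so by the
Fredholm alternative a compact resolvent at some complex point yields one at some real point, and
the latter is compact and self-adjoint.
-/

namespace QuantumKac

universe u v

section DiagonalOperators

variable {𝕜 E I : Type*} [RCLike 𝕜] [NormedAddCommGroup E] [InnerProductSpace 𝕜 E]

/-- The operator `A` is diagonal in the Hilbert basis `b`: each basis vector is an eigenvector. -/
def IsDiagonalIn (b : HilbertBasis I 𝕜 E) (A : E →L[𝕜] E) : Prop :=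
  ∀ i, ∃ c : 𝕜, A (b i) = c • b i

variable {b : HilbertBasis I 𝕜 E} {A B : E →L[𝕜] E}

theorem isDiagonalIn_iff_inner_eq_zero :
    IsDiagonalIn b A ↔ ∀ i j, i ≠ j → inner 𝕜 (b i) (A (b j)) = 0 := by
  refine ⟨fun hA i j hij => ?_, fun hA j => ⟨b.repr (A (b j)) j, ?_⟩⟩
  · obtain ⟨c, hc⟩ := hA j
    rw [hc, inner_smul_right, b.orthonormal.2 hij, mul_zero]
  · refine (b.hasSum_repr (A (b j))).unique (hasSum_single j fun i hij => ?_)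
    rw [b.repr_apply_apply, hA i j hij, zero_smul]

theorem IsDiagonalIn.mul_comm (hA : IsDiagonalIn b A) (hB : IsDiagonalIn b B) :
    A * B = B * A := by
  refine ContinuousLinearMap.ext_on
    (Submodule.dense_iff_topologicalClosure_eq_top.mpr b.dense_span) ?_
  rintro _ ⟨i, rfl⟩
  obtain ⟨a, ha⟩ := hA i
  obtain ⟨c, hc⟩ := hB i
  simp only [mul_apply_eq_comp, ha, hc, map_smul, smul_comm a c]

end DiagonalOperators

section ProductBasis

variable {N : ℕ} {H : Type u} [NormedAddCommGroup H] [InnerProductSpace ℂ H] {J : Type*}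

theorem prodVec_update_add (φ : Fin N → H) (k : Fin N) (x y : H) :
    prodVec (Function.update φ k (x + y))
      = prodVec (Function.update φ k x) + prodVec (Function.update φ k y) := by
  simp only [prodVec, MultilinearMap.map_update_add, UniformSpace.Completion.coe_add]

theorem prodVec_update_smul (φ : Fin N → H) (k : Fin N) (c : ℂ) (x : H) :
    prodVec (Function.update φ k (c • x)) = c • prodVec (Function.update φ k x) := by
  simp only [prodVec, MultilinearMap.map_update_smul, UniformSpace.Completion.coe_smul]

/-- The elementary tensor as a continuous linear function of its `k`th factor; the `k`th entry of
`φ` itself is irrelevant. -/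
noncomputable def prodVecFactor (φ : Fin N → H) (k : Fin N) : H →L[ℂ] TensorPower N H where
  toFun x := prodVec (Function.update φ k x)
  map_add' := prodVec_update_add φ k
  map_smul' := prodVec_update_smul φ k
  cont := continuous_prodVec.comp (continuous_const.update k continuous_id)

theorem prodVecFactor_self (φ : Fin N → H) (k : Fin N) :
    prodVecFactor φ k (φ k) = prodVec φ :=
  congrArg prodVec (Function.update_eq_self k φ)

theorem dense_span_prodVec_comp {ψ : J → H}
    (hψ : Dense (Submodule.span ℂ (Set.range ψ) : Set H)) :
    Dense (Submodule.span ℂ (Set.range fun α : Fin N → J => prodVec (ψ ∘ α)) :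
      Set (TensorPower N H)) := by
  set K := (Submodule.span ℂ (Set.range fun α : Fin N → J => prodVec (ψ ∘ α))).topologicalClosure
    with hK
  have mem_of_forall_notMem (s : Finset (Fin N)) :
      ∀ φ : Fin N → H, (∀ k ∉ s, φ k ∈ Set.range ψ) → prodVec φ ∈ K := by
    induction s using Finset.induction_on with
    | empty =>
      intro φ hφ
      choose α hα using fun k => hφ k (Finset.notMem_empty k)
      obtain rfl : ψ ∘ α = φ := funext hα
      exact Submodule.le_topologicalClosure _ (Submodule.subset_span ⟨α, rfl⟩)
    | insert k s _ ih =>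
      intro φ hφ
      have hle : Submodule.span ℂ (Set.range ψ) ≤ K.comap (prodVecFactor φ k).toLinearMap := by
        refine Submodule.span_le.mpr ?_
        rintro _ ⟨j, rfl⟩
        refine ih _ fun l hl => ?_
        rcases eq_or_ne l k with rfl | hlk
        · simp
        · simpa [hlk] using hφ l (by simp [hlk, hl])
      have hclosed : IsClosed (K.comap (prodVecFactor φ k).toLinearMap : Set H) :=
        (Submodule.isClosed_topologicalClosure _).preimage (prodVecFactor φ k).continuous
      rw [← prodVecFactor_self φ k]
      exact closure_minimal hle hclosed (hψ (φ k))
  rw [Submodule.dense_iff_topologicalClosure_eq_top, ← hK, eq_top_iff,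
    ← Submodule.dense_iff_topologicalClosure_eq_top.mp (dense_span_prodVec (N := N) (H := H))]
  refine Submodule.topologicalClosure_minimal _ (Submodule.span_le.mpr ?_)
    (Submodule.isClosed_topologicalClosure _)
  rintro _ ⟨φ, rfl⟩
  exact mem_of_forall_notMem Finset.univ φ (by simp)

theorem orthonormal_prodVec_comp {ψ : J → H} (hψ : Orthonormal ℂ ψ) :
    Orthonormal ℂ fun α : Fin N → J => prodVec (ψ ∘ α) := by
  classical
  rw [orthonormal_iff_ite]
  intro α β
  simp only [inner_prodVec, Function.comp_apply, orthonormal_iff_ite.mp hψ]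
  split_ifs with hαβ
  · simp [hαβ]
  · obtain ⟨k, hk⟩ := Function.ne_iff.mp hαβ
    exact Finset.prod_eq_zero (Finset.mem_univ k) (if_neg hk)

/-- The Hilbert basis `Ψ_α = ψ_{α₁} ⊗ ⋯ ⊗ ψ_{α_N}` of `H^{⊗N}` built from a Hilbert basis `ψ`
of `H`. -/
noncomputable def prodBasis (N : ℕ) (ψ : HilbertBasis J ℂ H) :
    HilbertBasis (Fin N → J) ℂ (TensorPower N H) :=
  HilbertBasis.mk (orthonormal_prodVec_comp ψ.orthonormal)
    (Submodule.dense_iff_topologicalClosure_eq_top.mp (dense_span_prodVec_comp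
      (Submodule.dense_iff_topologicalClosure_eq_top.mpr ψ.dense_span))).ge

theorem prodBasis_apply (ψ : HilbertBasis J ℂ H) (α : Fin N → J) :
    prodBasis N ψ α = prodVec (ψ ∘ α) := by
  rw [prodBasis, HilbertBasis.coe_mk]

end ProductBasis

section PairSlices

variable {N : ℕ} {H : Type u} [NormedAddCommGroup H] [InnerProductSpace ℂ H] {i j : Fin N}

theorem insertPair_self (hij : i ≠ j) (φ : Fin N → H) :
    insertPair i j φ (prodVec ![φ i, φ j]) = prodVec φ := by
  rw [insertPair_prodVec hij]
  exact congrArg prodVec (replacePair_self φ)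

theorem insertPair_replacePair (hij : i ≠ j) (φ : Fin N → H) (x y : H) :
    insertPair i j (replacePair i j φ x y) = insertPair i j φ := by
  refine ContinuousLinearMap.ext_on dense_span_prodVec ?_
  rintro _ ⟨z, rfl⟩
  rw [insertPair_prodVec hij, insertPair_prodVec hij]
  congr 1
  simp only [replacePair, Function.update_comm hij, Function.update_idem]

theorem adjoint_insertPair_comp_insertPair (hij : i ≠ j) (φ θ : Fin N → H) :
    (insertPair i j φ).adjoint ∘L insertPair i j θ
      = (∏ k ∈ (Finset.univ.erase j).erase i, inner ℂ (φ k) (θ k)) •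
        ContinuousLinearMap.id ℂ (TensorPower 2 H) := by
  ext v
  refine ext_inner_left ℂ fun u => ?_
  simp [ContinuousLinearMap.adjoint_inner_right, inner_insertPair hij, inner_smul_right]

section Isometry

variable {B : TensorPower 2 H →L[ℂ] TensorPower 2 H}

theorem pairOp_comp_insertPair (hij : i ≠ j) (hB : ∀ u v, inner ℂ (B u) (B v) = inner ℂ u v)
    (φ : Fin N → H) : pairOp i j B ∘L insertPair i j φ = insertPair i j φ ∘L B := by
  refine ContinuousLinearMap.ext_on dense_span_prodVec ?_
  rintro _ ⟨x, rfl⟩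
  have hx : ![replacePair i j φ (x 0) (x 1) i, replacePair i j φ (x 0) (x 1) j] = x := by
    funext k
    fin_cases k <;> simp [replacePair, hij]
  rw [ContinuousLinearMap.comp_apply, ContinuousLinearMap.comp_apply, insertPair_prodVec hij,
    pairOp_prodVec hij B hB, insertPair_replacePair hij, hx]

theorem adjoint_insertPair_comp_pairOp (hij : i ≠ j)
    (hB : ∀ u v, inner ℂ (B u) (B v) = inner ℂ u v) (φ : Fin N → H) :
    (insertPair i j φ).adjoint ∘L pairOp i j B = B ∘L (insertPair i j φ).adjoint := by
  refine ContinuousLinearMap.ext_on dense_span_prodVec ?_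
  rintro _ ⟨θ, rfl⟩
  have apply_insertPair (v : TensorPower 2 H) :=
    DFunLike.congr_fun (adjoint_insertPair_comp_insertPair hij φ θ) v
  simp only [ContinuousLinearMap.comp_apply, smul_apply,
    ContinuousLinearMap.id_apply] at apply_insertPair
  rw [ContinuousLinearMap.comp_apply, ContinuousLinearMap.comp_apply, pairOp_prodVec hij B hB,
    ← insertPair_self hij θ, apply_insertPair, apply_insertPair, map_smul]

end Isometry

/-- The two-particle slice of an operator `A` on `H^{⊗N}`: the operator on `H ⊗ H` whose matrix
elements are those of `A`, with the factors other than `i` and `j` frozen to `φ` on the left and to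
`θ` on the right. -/
noncomputable def pairSlice (i j : Fin N) (φ θ : Fin N → H)
    (A : TensorPower N H →L[ℂ] TensorPower N H) : TensorPower 2 H →L[ℂ] TensorPower 2 H :=
  (insertPair i j φ).adjoint ∘L A ∘L insertPair i j θ

theorem mul_pairSlice_comm (hij : i ≠ j) {B : TensorPower 2 H →L[ℂ] TensorPower 2 H}
    (hB : ∀ u v, inner ℂ (B u) (B v) = inner ℂ u v)
    {A : TensorPower N H →L[ℂ] TensorPower N H} (hA : pairOp i j B * A = A * pairOp i j B)
    (φ θ : Fin N → H) : B * pairSlice i j φ θ A = pairSlice i j φ θ A * B :=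
  calc (B ∘L (insertPair i j φ).adjoint) ∘L A ∘L insertPair i j θ
      = (insertPair i j φ).adjoint ∘L (pairOp i j B ∘L A) ∘L insertPair i j θ := by
        rw [← adjoint_insertPair_comp_pairOp hij hB]; rfl
    _ = (insertPair i j φ).adjoint ∘L A ∘L pairOp i j B ∘L insertPair i j θ := by
        rw [show pairOp i j B ∘L A = A ∘L pairOp i j B from hA]; rfl
    _ = ((insertPair i j φ).adjoint ∘L A ∘L insertPair i j θ) ∘L B := by
        rw [pairOp_comp_insertPair hij hB]; rfl

theorem inner_prodBasis_pairSlice {J : Type*} (hij : i ≠ j) (ψ : HilbertBasis J ℂ H)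
    (α β : Fin N → J) (A : TensorPower N H →L[ℂ] TensorPower N H) :
    inner ℂ (prodBasis 2 ψ ![α i, α j])
        (pairSlice i j (ψ ∘ α) (ψ ∘ β) A (prodBasis 2 ψ ![β i, β j]))
      = inner ℂ (prodBasis N ψ α) (A (prodBasis N ψ β)) := by
  have insert_pair (γ : Fin N → J) :
      insertPair i j (ψ ∘ γ) (prodBasis 2 ψ ![γ i, γ j]) = prodBasis N ψ γ := by
    have hpair : ψ ∘ ![γ i, γ j] = ![ψ (γ i), ψ (γ j)] := by
      funext k
      fin_cases k <;> rfl
    rw [prodBasis_apply, prodBasis_apply, hpair]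
    exact insertPair_self hij (ψ ∘ γ)
  rw [pairSlice, ContinuousLinearMap.comp_apply, ContinuousLinearMap.comp_apply,
    ContinuousLinearMap.adjoint_inner_right, insert_pair, insert_pair]

end PairSlices

section PairCommutant

variable {N : ℕ} {H : Type u} [NormedAddCommGroup H] [InnerProductSpace ℂ H] {C : Type*}
  {U : C → TensorPower 2 H →L[ℂ] TensorPower 2 H}

/-- The commutant of the operators `U_{i,j}(σ)`, `i < j`, on `H^{⊗N}`, for an arbitrary family `U`
of operators on `H ⊗ H`. -/
noncomputable def pairCommutant (U : C → TensorPower 2 H →L[ℂ] TensorPower 2 H) (N : ℕ) :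
    Subalgebra ℂ (TensorPower N H →L[ℂ] TensorPower N H) :=
  Subalgebra.centralizer ℂ {T | ∃ (i j : Fin N) (σ : C), i < j ∧ T = pairOp i j (U σ)}

theorem pairSlice_mem_centralizer (hU : ∀ σ u v, inner ℂ (U σ u) (U σ v) = inner ℂ u v)
    {A : TensorPower N H →L[ℂ] TensorPower N H} (hA : A ∈ pairCommutant U N) {i j : Fin N}
    (hij : i < j) (φ θ : Fin N → H) : pairSlice i j φ θ A ∈ (Set.range U).centralizer := by
  rintro _ ⟨σ, rfl⟩
  exact mul_pairSlice_comm hij.ne (hU σ)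
    (Subalgebra.mem_centralizer_iff ℂ |>.mp hA _ ⟨i, j, σ, hij, rfl⟩) φ θ

theorem exists_lt_pair_ne {J : Type*} (hN : 2 ≤ N) {α β : Fin N → J} (hαβ : α ≠ β) :
    ∃ i j, i < j ∧ ![α i, α j] ≠ ![β i, β j] := by
  obtain ⟨k, hk⟩ := Function.ne_iff.mp hαβ
  have : Nontrivial (Fin N) := Fin.nontrivial_iff_two_le.mpr hN
  obtain ⟨l, hl⟩ := exists_ne k
  rcases lt_or_gt_of_ne hl with hlk | hkl
  · exact ⟨l, k, hlk, fun heq => hk (congrFun heq 1)⟩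
  · exact ⟨k, l, hkl, fun heq => hk (congrFun heq 0)⟩

theorem isDiagonalIn_prodBasis_of_mem_pairCommutant {J : Type*} {ψ : HilbertBasis J ℂ H}
    (hU : ∀ σ u v, inner ℂ (U σ u) (U σ v) = inner ℂ u v)
    (hdiag : ∀ T ∈ (Set.range U).centralizer, IsDiagonalIn (prodBasis 2 ψ) T) (hN : 2 ≤ N)
    {A : TensorPower N H →L[ℂ] TensorPower N H} (hA : A ∈ pairCommutant U N) :
    IsDiagonalIn (prodBasis N ψ) A := by
  refine isDiagonalIn_iff_inner_eq_zero.mpr fun α β hαβ => ?_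
  obtain ⟨i, j, hij, hne⟩ := exists_lt_pair_ne hN hαβ
  rw [← inner_prodBasis_pairSlice hij.ne]
  exact isDiagonalIn_iff_inner_eq_zero.mp
    (hdiag _ (pairSlice_mem_centralizer hU hA hij _ _)) _ _ hne

end PairCommutant

section EnergyShells

variable {N : ℕ} {H : Type u} [NormedAddCommGroup H] [InnerProductSpace ℂ H] {h : H →ₗ.[ℂ] H}
  {J : Type*}

/-- The vectors `ψ j` lie in the domain of `h` and satisfy `h (ψ j) = e j • ψ j`. -/
def IsEigenfamily (h : H →ₗ.[ℂ] H) (ψ : J → H) (e : J → ℝ) : Prop :=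
  ∀ j, ∃ hj : ψ j ∈ h.domain, h ⟨ψ j, hj⟩ = (e j : ℂ) • ψ j

theorem IsEigenfamily.prodVec_mem_energyShell {φ : Fin N → H} {e : Fin N → ℝ}
    (hφ : IsEigenfamily h φ e) : prodVec φ ∈ energyShell N h (∑ k, e k) := by
  choose hd he using hφ
  have hmem : (prodVec φ, ∑ j, prodVec (Function.update φ j (h ⟨φ j, hd j⟩)))
      ∈ hamiltonianGraph N h :=
    Submodule.le_topologicalClosure _ (Submodule.subset_span ⟨fun k => ⟨φ k, hd k⟩, rfl⟩)
  have hsum : ∑ j, prodVec (Function.update φ j (h ⟨φ j, hd j⟩))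
      = ((∑ k, e k : ℝ) : ℂ) • prodVec φ := by
    simp only [he, prodVec_update_smul, Function.update_eq_self, Complex.ofReal_sum,
      Finset.sum_smul]
  rwa [hsum] at hmem

theorem inner_eq_zero_of_inner_ofReal_smul {𝕜 E : Type*} [RCLike 𝕜] [NormedAddCommGroup E]
    [InnerProductSpace 𝕜 E] {a b : ℝ} (hab : a ≠ b) {x y : E}
    (hxy : inner 𝕜 ((a : 𝕜) • x) y = inner 𝕜 x ((b : 𝕜) • y)) : inner 𝕜 x y = 0 := by
  rw [inner_smul_left, inner_smul_right, RCLike.conj_ofReal] at hxy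
  by_contra hne
  exact hab (RCLike.ofReal_injective (mul_right_cancel₀ hne hxy))

theorem starProjection_energyShell_eq_zero (hsymm : h.IsFormalAdjoint h) {E F : ℝ} (hEF : E ≠ F)
    {x : TensorPower N H} (hx : x ∈ energyShell N h E) :
    (energyShell N h F).starProjection x = 0 := by
  rw [Submodule.starProjection_apply_eq_zero_iff, Submodule.mem_orthogonal]
  exact fun y hy => inner_eq_zero_of_inner_ofReal_smul hEF.symm
    (hamiltonianGraph_symmetric hsymm hy hx)

theorem exists_eq_smul_of_mem_energyAlgebra (hsymm : h.IsFormalAdjoint h)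
    {A : TensorPower N H →L[ℂ] TensorPower N H} (hA : A ∈ energyAlgebra N h)
    {E : ℝ} {x : TensorPower N H} (hx : x ∈ energyShell N h E) : ∃ c : ℂ, A x = c • x := by
  rcases eq_or_ne x 0 with rfl | hx0
  · exact ⟨0, by simp⟩
  obtain ⟨f, -, hf⟩ := hA
  have hE : E ∈ energySpectrum N h := (Submodule.ne_bot_iff _).mpr ⟨x, hx, hx0⟩
  refine ⟨f ⟨E, hE⟩, (hf x).unique ?_⟩
  have hsum := hasSum_single (f := fun F : energySpectrum N h =>
    f F • (energyShell N h F).starProjection x) ⟨E, hE⟩ fun F hF => by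
      rw [starProjection_energyShell_eq_zero hsymm (fun hEF => hF (Subtype.ext hEF.symm)) hx,
        smul_zero]
  rwa [Submodule.starProjection_eq_self_iff.mpr hx] at hsum

theorem isDiagonalIn_prodBasis_of_mem_energyAlgebra (hsymm : h.IsFormalAdjoint h)
    {ψ : HilbertBasis J ℂ H} {e : J → ℝ} (hψ : IsEigenfamily h ψ e)
    {A : TensorPower N H →L[ℂ] TensorPower N H} (hA : A ∈ energyAlgebra N h) :
    IsDiagonalIn (prodBasis N ψ) A := fun α => by
  rw [prodBasis_apply]
  have hα : IsEigenfamily h (ψ ∘ α) (e ∘ α) := fun k => hψ (α k)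
  exact exists_eq_smul_of_mem_energyAlgebra hsymm hA hα.prodVec_mem_energyShell

theorem isDiagonalIn_prodBasis_of_isEigenfamily {C : Type*}
    {U : C → TensorPower 2 H →L[ℂ] TensorPower 2 H} (hsymm : h.IsFormalAdjoint h)
    (hU : ∀ σ u v, inner ℂ (U σ u) (U σ v) = inner ℂ u v)
    (herg : (Set.range U).centralizer ⊆ energyAlgebra 2 h) (hN : 2 ≤ N)
    {ψ : HilbertBasis J ℂ H} {e : J → ℝ} (hψ : IsEigenfamily h ψ e)
    {A : TensorPower N H →L[ℂ] TensorPower N H} (hA : A ∈ pairCommutant U N) :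
    IsDiagonalIn (prodBasis N ψ) A :=
  isDiagonalIn_prodBasis_of_mem_pairCommutant hU
    (fun _ hT => isDiagonalIn_prodBasis_of_mem_energyAlgebra hsymm hψ (herg hT)) hN hA

end EnergyShells

section CountableEigenvalues

variable {𝕜 E : Type*} [RCLike 𝕜] [NormedAddCommGroup E] [InnerProductSpace 𝕜 E]
  [TopologicalSpace.SeparableSpace E]

theorem countable_of_orthonormal {ι : Type*} {v : ι → E} (hv : Orthonormal 𝕜 v) :
    Countable ι := by
  have hdisj : Pairwise (Function.onFun Disjoint fun i => Metric.ball (v i) (1 / 2)) := by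
    intro i j hij
    refine Metric.ball_disjoint_ball ?_
    have hsq : ‖v i - v j‖ ^ 2 = 2 := by
      rw [norm_sub_sq (𝕜 := 𝕜), hv.1, hv.1, hv.2 hij]
      norm_num
    rw [dist_eq_norm]
    nlinarith [norm_nonneg (v i - v j)]
  exact hdisj.countable_of_isOpen_disjoint (fun _ => Metric.isOpen_ball)
    fun i => ⟨v i, Metric.mem_ball_self (by norm_num)⟩

theorem countable_of_pairwise_inner_eq_zero {ι : Type*} {v : ι → E} (hv0 : ∀ i, v i ≠ 0)
    (hv : Pairwise fun i j => inner 𝕜 (v i) (v j) = 0) : Countable ι := by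
  refine countable_of_orthonormal (𝕜 := 𝕜) (v := fun i => ((‖v i‖ : 𝕜)⁻¹) • v i)
    ⟨fun i => norm_smul_inv_norm (hv0 i), fun i j hij => ?_⟩
  have hvij : inner 𝕜 (v i) (v j) = 0 := hv hij
  simp only [inner_smul_left, inner_smul_right, hvij, mul_zero]

theorem countable_eigenvalues {h : E →ₗ.[𝕜] E} (hsymm : h.IsFormalAdjoint h) :
    {l : ℝ | ∃ x : h.domain, x ≠ 0 ∧ h x = (l : 𝕜) • (x : E)}.Countable := by
  choose v hv0 hv using fun l : {l : ℝ | ∃ x : h.domain, x ≠ 0 ∧ h x = (l : 𝕜) • (x : E)} => l.2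
  refine Set.countable_coe_iff.mp (countable_of_pairwise_inner_eq_zero (𝕜 := 𝕜)
    (v := fun l => (v l : E)) (fun l => by simpa using hv0 l) fun l m hlm => ?_)
  refine inner_eq_zero_of_inner_ofReal_smul (Subtype.coe_injective.ne hlm) ?_
  rw [← hv, ← hv]
  exact hsymm _ _

end CountableEigenvalues

section RightResolvents

variable {𝕜 E : Type*} [RCLike 𝕜] [NormedAddCommGroup E] [InnerProductSpace 𝕜 E]

/-- The bounded operator `R` maps into the domain of `h` and is a right inverse of `h - z`. -/
def IsRightResolvent (h : E →ₗ.[𝕜] E) (z : 𝕜) (R : E →L[𝕜] E) : Prop :=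
  ∀ y : E, ∃ x : h.domain, (x : E) = R y ∧ h x - z • (x : E) = y

namespace IsRightResolvent

variable {h : E →ₗ.[𝕜] E} {z : 𝕜} {R : E →L[𝕜] E}

theorem exists_apply_eq_smul (hR : IsRightResolvent h z R) {μ : 𝕜} {x : E} (hx : x ≠ 0)
    (hμ : R x = μ • x) : ∃ hd : x ∈ h.domain, h ⟨x, hd⟩ = (z + μ⁻¹) • x := by
  obtain ⟨y, hy, hyx⟩ := hR x
  have hμ0 : μ ≠ 0 := by
    rintro rfl
    obtain rfl : y = 0 := Subtype.ext (by rw [hy, hμ, zero_smul]; rfl)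
    exact hx (by simpa using hyx.symm)
  have hxy : x = μ⁻¹ • (y : E) := by rw [hy, hμ, inv_smul_smul₀ hμ0]
  refine ⟨hxy ▸ h.domain.smul_mem _ y.2, ?_⟩
  calc h ⟨x, _⟩ = μ⁻¹ • h y := by rw [← h.map_smul]; congr 1; exact Subtype.ext hxy
    _ = μ⁻¹ • (x + z • (y : E)) := by rw [← hyx, sub_add_cancel]
    _ = (z + μ⁻¹) • x := by rw [smul_add, smul_comm, ← hxy, add_smul, add_comm]

theorem isSymmetric (hsymm : h.IsFormalAdjoint h) {l : ℝ} (hR : IsRightResolvent h (l : 𝕜) R) :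
    R.IsSymmetric := fun a b => by
  obtain ⟨x, hx, hxa⟩ := hR a
  obtain ⟨y, hy, hyb⟩ := hR b
  change inner 𝕜 (R a) b = inner 𝕜 a (R b)
  rw [← hx, ← hy, ← hxa, ← hyb, inner_sub_left, inner_sub_right, hsymm x y, inner_smul_left,
    inner_smul_right, RCLike.conj_ofReal]

/-- The resolvent identity `R(w) = R(z) (1 - (w - z) R(z))⁻¹`. -/
theorem comp_inv (hR : IsRightResolvent h z R) {w : 𝕜} {Q : (E →L[𝕜] E)ˣ}
    (hQ : (Q : E →L[𝕜] E) = 1 - (w - z) • R) :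
    IsRightResolvent h w (R ∘L (↑Q⁻¹ : E →L[𝕜] E)) := fun y => by
  obtain ⟨x, hx, hxy⟩ := hR ((↑Q⁻¹ : E →L[𝕜] E) y)
  refine ⟨x, hx, ?_⟩
  calc h x - w • (x : E) = (h x - z • (x : E)) - (w - z) • (x : E) := by rw [sub_smul]; abel
    _ = (1 - (w - z) • R) ((↑Q⁻¹ : E →L[𝕜] E) y) := by rw [hxy, hx]; rfl
    _ = y := by rw [← hQ, ← mul_apply_eq_comp, Units.mul_inv, one_apply_eq_self]

end IsRightResolvent

end RightResolvents

section CompactResolvent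

theorem isUnit_one_sub_smul_of_isCompactOperator {𝕜 X : Type*} [NontriviallyNormedField 𝕜]
    [NormedAddCommGroup X] [NormedSpace 𝕜 X] [CompleteSpace X] {R : X →L[𝕜] X}
    (hR : IsCompactOperator R) {w : 𝕜}
    (hw : w ≠ 0 → ¬ Module.End.HasEigenvalue (R : Module.End 𝕜 X) w⁻¹) :
    IsUnit (1 - w • R) := by
  rcases eq_or_ne w 0 with rfl | hw0
  · simp
  have hunit : IsUnit (algebraMap 𝕜 (X →L[𝕜] X) w⁻¹ - R) := spectrum.mem_resolventSet_iff.mp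
    ((hR.hasEigenvalue_or_mem_resolventSet (inv_ne_zero hw0)).resolve_left (hw hw0))
  have hsmul : 1 - w • R = Units.mk0 w hw0 • (algebraMap 𝕜 (X →L[𝕜] X) w⁻¹ - R) := by
    rw [Units.smul_mk0, smul_sub, Algebra.algebraMap_eq_smul_one, smul_inv_smul₀ hw0]
  exact hsmul ▸ hunit.smul _

theorem orthogonal_span_sigma_hilbertBasis {𝕜 E ι : Type*} [RCLike 𝕜] [NormedAddCommGroup E]
    [InnerProductSpace 𝕜 E] {w : ι → Type*} {V : ι → Submodule 𝕜 E}
    (b : ∀ i, HilbertBasis (w i) 𝕜 (V i)) :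
    (Submodule.span 𝕜 (Set.range fun a : Σ i, w i => (b a.1 a.2 : E)))ᗮ = (⨆ i, V i)ᗮ := by
  refine le_antisymm ?_ (Submodule.orthogonal_le (Submodule.span_le.mpr ?_))
  · rw [← Submodule.iInf_orthogonal]
    refine le_iInf fun i y hy => (Submodule.mem_orthogonal' _ y).mpr fun x hx => ?_
    have hzero : innerSL 𝕜 y ∘L (V i).subtypeL = 0 := by
      refine ContinuousLinearMap.ext_on
        (Submodule.dense_iff_topologicalClosure_eq_top.mpr (b i).dense_span) ?_
      rintro _ ⟨k, rfl⟩
      exact (Submodule.mem_orthogonal' _ y).mp hy _ (Submodule.subset_span ⟨⟨i, k⟩, rfl⟩)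
    exact DFunLike.congr_fun hzero ⟨x, hx⟩
  · rintro _ ⟨⟨i, k⟩, rfl⟩
    exact Submodule.mem_iSup_of_mem i (b i k).2

theorem exists_hilbertBasis_eigenvectors {𝕜 : Type v} {E : Type u} [RCLike 𝕜]
    [NormedAddCommGroup E] [InnerProductSpace 𝕜 E] [CompleteSpace E] {T : E →L[𝕜] E}
    (hT : IsCompactOperator T) (hsymm : T.IsSymmetric) :
    ∃ (J : Type (max u v)) (ψ : HilbertBasis J 𝕜 E) (μ : J → ℝ),
      ∀ j, T (ψ j) = (μ j : 𝕜) • ψ j := by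
  have hcomplete (μ : 𝕜) : CompleteSpace (Module.End.eigenspace (T : Module.End 𝕜 E) μ) :=
    (ContinuousLinearMap.isClosed_eigenspace T μ).completeSpace_coe
  choose w b _ using fun μ : 𝕜 =>
    exists_hilbertBasis 𝕜 (Module.End.eigenspace (T : Module.End 𝕜 E) μ)
  have hv : Orthonormal 𝕜 fun a : Σ μ : 𝕜, w μ => (b a.1 a.2 : E) :=
    hsymm.orthogonalFamily_eigenspaces.orthonormal_sigma_orthonormal fun μ => (b μ).orthonormal
  have htotal : (Submodule.span 𝕜 (Set.range fun a : Σ μ : 𝕜, w μ => (b a.1 a.2 : E)))ᗮ = ⊥ :=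
    (orthogonal_span_sigma_hilbertBasis b).trans
      (T.orthogonalComplement_iSup_eigenspaces_eq_bot hT hsymm)
  refine ⟨_, HilbertBasis.mkOfOrthogonalEqBot hv htotal, fun a => RCLike.re a.1, fun a => ?_⟩
  rw [HilbertBasis.coe_mkOfOrthogonalEqBot]
  have hreal : ((RCLike.re a.1 : ℝ) : 𝕜) = a.1 :=
    RCLike.conj_eq_iff_re.mp (hsymm.conj_eigenvalue_eq_self
      (Module.End.hasEigenvalue_of_hasEigenvector ⟨(b a.1 a.2).2, hv.ne_zero a⟩))
  rw [hreal]
  exact Module.End.mem_eigenspace_iff.mp (b a.1 a.2).2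

variable {H : Type u} [NormedAddCommGroup H] [InnerProductSpace ℂ H] [CompleteSpace H]
  [TopologicalSpace.SeparableSpace H] {h : H →ₗ.[ℂ] H}

theorem HasCompactResolvent.exists_real_isRightResolvent (hres : HasCompactResolvent h)
    (hsymm : h.IsFormalAdjoint h) :
    ∃ (l : ℝ) (T : H →L[ℂ] H), IsCompactOperator T ∧ IsRightResolvent h (l : ℂ) T := by
  obtain ⟨z, R, hR, -, hRz⟩ := hres
  replace hRz : IsRightResolvent h z R := hRz
  obtain ⟨l, hl⟩ : ∃ l : ℝ, ¬ ∃ x : h.domain, x ≠ 0 ∧ h x = (l : ℂ) • (x : H) := by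
    by_contra! hall
    exact Cardinal.not_countable_real ((countable_eigenvalues hsymm).mono fun l _ => hall l)
  have hunit : IsUnit (1 - ((l : ℂ) - z) • R) := by
    refine isUnit_one_sub_smul_of_isCompactOperator hR fun _ hev => ?_
    obtain ⟨x, hx⟩ := hev.exists_hasEigenvector
    obtain ⟨hd, hhx⟩ := hRz.exists_apply_eq_smul hx.2 hx.apply_eq_smul
    rw [inv_inv, add_sub_cancel] at hhx
    exact hl ⟨⟨x, hd⟩, fun h0 => hx.2 (congrArg Subtype.val h0), hhx⟩
  obtain ⟨Q, hQ⟩ := hunit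
  exact ⟨l, _, hR.comp_clm _, hRz.comp_inv hQ⟩

theorem HasCompactResolvent.exists_eigenbasis (hres : HasCompactResolvent h)
    (hsymm : h.IsFormalAdjoint h) :
    ∃ (J : Type u) (ψ : HilbertBasis J ℂ H) (e : J → ℝ), IsEigenfamily h ψ e := by
  obtain ⟨l, T, hT, hTl⟩ := hres.exists_real_isRightResolvent hsymm
  obtain ⟨J, ψ, μ, hψ⟩ := exists_hilbertBasis_eigenvectors hT (hTl.isSymmetric hsymm)
  refine ⟨J, ψ, fun j => l + (μ j)⁻¹, fun j => ?_⟩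
  push_cast
  exact hTl.exists_apply_eq_smul (ψ.orthonormal.ne_zero j) (hψ j)

end CompactResolvent

theorem isFormalAdjoint_self_of_isSelfAdjoint {𝕜 E : Type*} [RCLike 𝕜] [NormedAddCommGroup E]
    [InnerProductSpace 𝕜 E] [CompleteSpace E] {h : E →ₗ.[𝕜] E} (hsa : IsSelfAdjoint h) :
    h.IsFormalAdjoint h := by
  have hadj := LinearPMap.adjoint_isFormalAdjoint hsa.dense_domain
  rwa [LinearPMap.isSelfAdjoint_def.mp hsa] at hadj

end QuantumKac

open QuantumKac in
theorem theorem2p9_general {H : Type*} [NormedAddCommGroup H] [InnerProductSpace ℂ H]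
    (h : H →ₗ.[ℂ] H) (hsymm : h.IsFormalAdjoint h)
    (hbasis : ∃ (J : Type*) (ψ : HilbertBasis J ℂ H) (e : J → ℝ), IsEigenfamily h ψ e)
    {C : Type*} (U : C → TensorPower 2 H →L[ℂ] TensorPower 2 H)
    (hU : ∀ σ u v, inner ℂ (U σ u) (U σ v) = inner ℂ u v)
    (herg : (Set.range U).centralizer ⊆ energyAlgebra 2 h) (N : ℕ) (hN : 2 ≤ N) :
    (∀ A ∈ pairCommutant U N, ∀ B ∈ pairCommutant U N, A * B = B * A) ∧
      ∀ (J : Type*) (ψ : HilbertBasis J ℂ H) (e : J → ℝ), IsEigenfamily h ψ e →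
        ∀ A ∈ pairCommutant U N, ∀ α : Fin N → J, ∃ c : ℂ,
          A (prodVec fun k => ψ (α k)) = c • prodVec fun k => ψ (α k) := by
  obtain ⟨_, ψ₀, e₀, hψ₀⟩ := hbasis
  refine ⟨fun A hA B hB => ?_, fun J ψ e hψ A hA α => ?_⟩
  · exact (isDiagonalIn_prodBasis_of_isEigenfamily hsymm hU herg hN hψ₀ hA).mul_comm
      (isDiagonalIn_prodBasis_of_isEigenfamily hsymm hU herg hN hψ₀ hB)
  · have hα := isDiagonalIn_prodBasis_of_isEigenfamily hsymm hU herg hN hψ hA α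
    rwa [prodBasis_apply] at hα

theorem theorem2p9 {H : Type*} [NormedAddCommGroup H] [InnerProductSpace ℂ H] [CompleteSpace H]
    [TopologicalSpace.SeparableSpace H]
    (h : H →ₗ.[ℂ] H) (hsa : IsSelfAdjoint h) (hres : QuantumKac.HasCompactResolvent h)
    {C : Type*} [MetricSpace C] [CompactSpace C] [MeasurableSpace C] [BorelSpace C]
    (S : QuantumKac.CollisionSpecification h C) (hS : S.IsErgodic) (N : ℕ) (hN : 2 ≤ N) :
    (∀ A ∈ S.commutant N, ∀ B ∈ S.commutant N, A * B = B * A) ∧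
      ∀ (J : Type*) (ψ : HilbertBasis J ℂ H) (e : J → ℝ),
        (∀ j, ∃ hj : ψ j ∈ h.domain, h ⟨ψ j, hj⟩ = (e j : ℂ) • ψ j) →
        ∀ A ∈ S.commutant N, ∀ α : Fin N → J, ∃ c : ℂ,
          A (QuantumKac.prodVec fun k => ψ (α k)) = c • QuantumKac.prodVec fun k => ψ (α k) := by
  have hsymm := QuantumKac.isFormalAdjoint_self_of_isSelfAdjoint hsa
  exact theorem2p9_general h hsymm (hres.exists_eigenbasis hsymm) (fun σ => S.U σ)
    (fun σ => Unitary.inner_map_map (S.U σ)) (Eq.subset hS) N hN
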